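/- For an integer $p\ge 1$ and $x,y\in\mathbb{R}$ put $$\mathrm{power}_p(x,y)=\frac{\operatorname{sign}(x)+\operatorname{sign}(y)}{2}\,\frac{x+y}{2}\left(1-\left|\frac{x-y}{x+y}\right|^p\right),$$ with $\operatorname{sign}(0)=0$ and $\mathrm{power}_p(x,y)=0$ when $x+y=0$. For a real sequence $f=(f_n)_{n\in\mathbb{Z}}$ let $Df_n=f_{n+1}-2f_n+f_{n-1}$. The Power-P subdivision scheme $S=S_{\mathrm{power}_p}$ is obtained from the centered four-point Lagrange interpolatory scheme by replacing the arithmetic mean of $Df_n$ and $Df_{n+1}$ by $\mathrm{power}_p(Df_n,Df_{n+1})$: $$S(f)_{2n}=f_n,\qquad S(f)_{2n+1}=\frac{f_n+f_{n+1}}{2}-\frac18\,\mathrm{power}_p(Df_n,Df_{n+1})\qquad(n\in\mathbb{Z}).$$ For $0<\alpha\le 1$ let $C^{\alpha-}$ be the set of bounded continuous functions $g:\mathbb{R}\to\mathbb{R}$ such that for every $\alpha'$ with $0<\alpha'<\alpha$ there is $C>0$ with $|g(x)-g(y)|\le C|x-y|^{\alpha'}$ for all $x,y\in\mathbb{R}$.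 **Proposition.** Let $p\ge 1$ be an integer. The Power-P subdivision scheme is uniformly convergent: for every $f\in\ell^\infty(\mathbb{Z})$ there is a continuous function $f^\infty:\mathbb{R}\to\mathbb{R}$ with $$\lim_{j\to+\infty}\ \sup_{n\in\mathbb{Z}}\left|S^j(f)_n-f^\infty(2^{-j}n)\right|=0 .$$ Moreover, for every $f\in\ell^\infty(\mathbb{Z})$, the limit function $f^\infty$ belongs to $C^{1-}$ if $p\le 4$, and to $C^{(-\log_2(3/4))-}$ if $p\ge 5$. -/

import Mathlib

open Filter Topology
open scoped ENNReal

noncomputable section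

namespace PowerP

/-- The second order differences `(Df)_n = f_{n+1} - 2 f_n + f_{n-1}`. -/
def secondDiff (f : ℤ → ℝ) (n : ℤ) : ℝ := f (n + 1) - 2 * f n + f (n - 1)

/-- The mean `power_p (x, y)`, with `sign 0 = 0`. When `x + y = 0` the factor `sign x + sign y`
vanishes, so the value is `0` whatever meaning is given to the quotient. -/
def powerMean (p : ℕ) (x y : ℝ) : ℝ :=
  (Real.sign x + Real.sign y) / 2 * ((x + y) / 2) * (1 - |(x - y) / (x + y)| ^ p)

/-- The interpolatory four-point scheme built on a mean `m` of two consecutive second order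
differences; the arithmetic mean gives the centered four-point Lagrange scheme.
Here `k / 2` is the floor, so `k = 2 * (k / 2)` for even `k` and `k = 2 * (k / 2) + 1` for odd. -/
def fourPointScheme (m : ℝ → ℝ → ℝ) (f : ℤ → ℝ) (k : ℤ) : ℝ :=
  if Even k then f (k / 2)
  else (f (k / 2) + f (k / 2 + 1)) / 2
    - 1 / 8 * m (secondDiff f (k / 2)) (secondDiff f (k / 2 + 1))

theorem fourPointScheme_even (m : ℝ → ℝ → ℝ) (f : ℤ → ℝ) (n : ℤ) :
    fourPointScheme m f (2 * n) = f n := by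
  simp [fourPointScheme]

theorem fourPointScheme_odd (m : ℝ → ℝ → ℝ) (f : ℤ → ℝ) (n : ℤ) :
    fourPointScheme m f (2 * n + 1) = (f n + f (n + 1)) / 2
      - 1 / 8 * m (secondDiff f n) (secondDiff f (n + 1)) := by
  have h : ¬ Even (2 * n + 1) := by simp
  have h2 : (2 * n + 1) / 2 = n := by omega
  rw [fourPointScheme, if_neg h, h2]

/-- The Power-P subdivision scheme. -/
def powerScheme (p : ℕ) : (ℤ → ℝ) → (ℤ → ℝ) := fourPointScheme (powerMean p)

/-- `g` is a (continuous) limit function of the scheme `S` started at `f`: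
`sup_n |S^j(f)_n - g(2^{-j} n)| → 0` as `j → ∞` (the supremum is taken in `[0, ∞]`). -/
def IsLimitFunction (S : (ℤ → ℝ) → (ℤ → ℝ)) (f : ℤ → ℝ) (g : ℝ → ℝ) : Prop :=
  Continuous g ∧
    Tendsto (fun j : ℕ => ⨆ n : ℤ, edist (S^[j] f n) (g ((n : ℝ) / 2 ^ j))) atTop (𝓝 0)

/-- Uniform convergence of a subdivision scheme on `ℓ^∞(ℤ)`. -/
def UniformlyConvergent (S : (ℤ → ℝ) → (ℤ → ℝ)) : Prop :=
  ∀ f : ℤ → ℝ, Memℓp f ∞ → ∃ g : ℝ → ℝ, IsLimitFunction S f g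

/-- The class `C^{α-}` for `0 < α ≤ 1`: bounded continuous functions that are globally
Hölder continuous of every positive exponent `a < α`. -/
def HolderMinus (α : ℝ) (g : ℝ → ℝ) : Prop :=
  Continuous g ∧ (∃ B : ℝ, ∀ x, |g x| ≤ B) ∧
    ∀ a : ℝ, 0 < a → a < α → ∃ C : ℝ, 0 < C ∧ ∀ x y : ℝ, |g x - g y| ≤ C * |x - y| ^ a

end PowerP

end

/-!
Only three properties of the mean `m = power_p` matter: `0 ≤ m x y ≤ max |x| |y|`, and `m x y = 0`
when `x * y ≤ 0`. Write `d` for the second differences of the data and `d'` for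
those of the refined data, so that `d'_{2n+1} = m(d_n, d_{n+1}) / 4` and
`d'_{2n} = d_n / 2 - (m(d_{n-1}, d_n) + m(d_n, d_{n+1})) / 8`. In general this only gives
`sup |d'| ≤ (3/4) sup |d|`, the worst case being a run of negative terms. After one step, however,
the terms with odd index are nonnegative, so a negative `d_n` has nonnegative neighbours, both means
vanish, and `sup |d'| ≤ (1/2) sup |d|`. Hence the second differences at level `j` are `O(2^{-j})`,
the first differences are `O(j 2^{-j})`, thus `O(r^j)` for every `r > 1/2`, and an interpolatory
scheme with this decay converges uniformly to a limit in `C^{1-}`.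
-/

noncomputable section

namespace PowerP

section Floor

variable {R : Type*} [Ring R] [LinearOrder R] [IsStrictOrderedRing R] [FloorRing R]

theorem floor_eq_or_eq_add_one_of_le {x y : R} (hxy : x ≤ y) (hyx : y ≤ x + 1) :
    ⌊y⌋ = ⌊x⌋ ∨ ⌊y⌋ = ⌊x⌋ + 1 := by
  have lower : ⌊x⌋ ≤ ⌊y⌋ := Int.floor_mono hxy
  have upper : ⌊y⌋ ≤ ⌊x⌋ + 1 := (Int.floor_mono hyx).trans_eq (Int.floor_add_one x)
  lia

theorem floor_two_mul_eq_or (x : R) : ⌊2 * x⌋ = 2 * ⌊x⌋ ∨ ⌊2 * x⌋ = 2 * ⌊x⌋ + 1 := by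
  have lower := Int.le_floor_add x x
  have upper := Int.le_floor_add_floor x x
  rw [two_mul]
  lia

theorem tendsto_floor_mul_div_atTop {k : Type*} [Field k] [LinearOrder k]
    [IsStrictOrderedRing k] [FloorRing k] [TopologicalSpace k] [OrderTopology k] (x : k) :
    Tendsto (fun c : k => (⌊c * x⌋ : k) / c) atTop (𝓝 x) := by
  have hlower : Tendsto (fun c : k => x - c⁻¹) atTop (𝓝 x) := by
    simpa using tendsto_const_nhds.sub (tendsto_inv_atTop_zero (𝕜 := k))
  refine tendsto_of_tendsto_of_tendsto_of_le_of_le' hlower tendsto_const_nhds ?_ ?_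
  · filter_upwards [eventually_gt_atTop 0] with c hc
    rw [le_div_iff₀ hc, sub_mul, inv_mul_cancel₀ hc.ne', mul_comm x]
    exact (Int.sub_one_lt_floor _).le
  · filter_upwards [eventually_gt_atTop 0] with c hc
    rw [div_le_iff₀ hc, mul_comm x]
    exact Int.floor_le _

end Floor

section DyadicModulus

variable {X E : Type*} [PseudoMetricSpace X] [PseudoMetricSpace E] {g : X → E} {L r : ℝ}

theorem uniformContinuous_of_dyadic_modulus (hr0 : 0 ≤ r) (hr1 : r < 1)
    (hg : ∀ (j : ℕ) (x y : X), dist x y ≤ (1 / 2) ^ j → dist (g x) (g y) ≤ L * r ^ j) :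
    UniformContinuous g := by
  rw [Metric.uniformContinuous_iff]
  intro ε hε
  have hlim : Tendsto (fun j : ℕ => L * r ^ j) atTop (𝓝 0) := by
    simpa using (tendsto_pow_atTop_nhds_zero_of_lt_one hr0 hr1).const_mul L
  obtain ⟨j, hj⟩ := (hlim.eventually_lt_const hε).exists
  exact ⟨(1 / 2) ^ j, by positivity, fun x y hxy => (hg j x y hxy.le).trans_lt hj⟩

theorem exists_dist_le_mul_rpow_of_dyadic_modulus {a : ℝ} (ha : 0 < a)
    (hbdd : Bornology.IsBounded (Set.range g))
    (hg : ∀ (j : ℕ) (x y : X), dist x y ≤ (1 / 2) ^ j →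
      dist (g x) (g y) ≤ L * ((1 / 2 : ℝ) ^ a) ^ j) :
    ∃ C : ℝ, 0 < C ∧ ∀ x y, dist (g x) (g y) ≤ C * dist x y ^ a := by
  set r : ℝ := (1 / 2) ^ a with hr
  have hr0 : 0 < r := by positivity
  obtain ⟨D, hD⟩ := Metric.isBounded_range_iff.1 hbdd
  refine ⟨max (max (L / r) D) 1, by positivity, fun x y => ?_⟩
  have hL : L / r ≤ max (max (L / r) D) 1 := le_max_of_le_left (le_max_left _ _)
  have hD' : D ≤ max (max (L / r) D) 1 := le_max_of_le_left (le_max_right _ _)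
  set C := max (max (L / r) D) 1
  have hC : 0 < C := lt_max_of_lt_right one_pos
  rcases lt_or_ge 1 (dist x y) with hfar | hnear
  · calc dist (g x) (g y) ≤ C := (hD x y).trans hD'
      _ ≤ C * dist x y ^ a := le_mul_of_one_le_right hC.le (Real.one_le_rpow hfar.le ha.le)
  rcases (dist_nonneg (x := x) (y := y)).eq_or_lt with hzero | hpos
  · have hsmall (j : ℕ) : dist (g x) (g y) ≤ L * r ^ j :=
      hg j x y (hzero ▸ by positivity)
    have hr1 : r < 1 := Real.rpow_lt_one (by norm_num) (by norm_num) ha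
    have hlim : Tendsto (fun j : ℕ => L * r ^ j) atTop (𝓝 0) := by
      simpa using (tendsto_pow_atTop_nhds_zero_of_lt_one hr0.le hr1).const_mul L
    exact (ge_of_tendsto' hlim hsmall).trans (by positivity)
  · obtain ⟨j, hj, hj'⟩ := exists_nat_pow_near_of_lt_one hpos hnear
      (by norm_num : (0 : ℝ) < 1 / 2) (by norm_num)
    have hscale : r ^ (j + 1) ≤ dist x y ^ a := by
      rw [hr, Real.rpow_pow_comm (by norm_num)]
      gcongr
    calc dist (g x) (g y) ≤ L * r ^ j := hg j x y hj'
      _ = L / r * r ^ (j + 1) := by rw [pow_succ', ← mul_assoc, div_mul_cancel₀ _ hr0.ne']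
      _ ≤ C * dist x y ^ a := by gcongr

end DyadicModulus

/-- The step function with value `F j n` on the dyadic interval `[n / 2 ^ j, (n + 1) / 2 ^ j)`;
it turns data on the grids `2 ^ (-j) ℤ` into functions on `ℝ` whose pointwise limit can be taken. -/
def dyadicStep {E : Type*} (F : ℕ → ℤ → E) (j : ℕ) (x : ℝ) : E := F j ⌊2 ^ j * x⌋

theorem dyadicStep_div_two_pow {E : Type*} (F : ℕ → ℤ → E) (j : ℕ) (n : ℤ) :
    dyadicStep F j ((n : ℝ) / 2 ^ j) = F j n := by
  rw [dyadicStep, mul_div_cancel₀ _ (by positivity), Int.floor_intCast]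

/-- Data `F j` on the grids `2 ^ (-j) ℤ` produced by an interpolatory refinement, whose first
differences decay geometrically with ratio `r`. -/
structure IsGeometricRefinement {E : Type*} [PseudoMetricSpace E] (F : ℕ → ℤ → E) (K r : ℝ) :
    Prop where
  interpolates : ∀ j n, F (j + 1) (2 * n) = F j n
  dist_le : ∀ j n, dist (F j (n + 1)) (F j n) ≤ K * r ^ j

namespace IsGeometricRefinement

variable {E : Type*} [PseudoMetricSpace E] {F : ℕ → ℤ → E} {K r : ℝ} {g : ℝ → E}

theorem mul_pow_nonneg (hF : IsGeometricRefinement F K r) (j : ℕ) : 0 ≤ K * r ^ j :=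
  dist_nonneg.trans (hF.dist_le j 0)

theorem dist_dyadicStep_succ_le (hF : IsGeometricRefinement F K r) (j : ℕ) (x : ℝ) :
    dist (dyadicStep F j x) (dyadicStep F (j + 1) x) ≤ K * r * r ^ j := by
  rw [mul_assoc, ← pow_succ', dyadicStep, dyadicStep, ← hF.interpolates, dist_comm, pow_succ',
    mul_assoc 2]
  rcases floor_two_mul_eq_or (2 ^ j * x) with h | h <;> rw [h]
  · rw [dist_self]
    exact hF.mul_pow_nonneg _
  · exact hF.dist_le _ _

theorem dist_dyadicStep_le (hF : IsGeometricRefinement F K r) {j : ℕ} {x y : ℝ}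
    (hxy : dist x y ≤ (1 / 2) ^ j) : dist (dyadicStep F j x) (dyadicStep F j y) ≤ K * r ^ j := by
  wlog h : y ≤ x generalizing x y
  · rw [dist_comm]
    exact this (by rwa [dist_comm]) (le_of_not_ge h)
  have hscaled : (2 : ℝ) ^ j * x ≤ 2 ^ j * y + 1 := by
    have hle : (2 : ℝ) ^ j * (x - y) ≤ 2 ^ j * (1 / 2) ^ j := by
      gcongr
      exact (le_abs_self _).trans hxy
    rw [← mul_pow, mul_one_div_cancel two_ne_zero, one_pow, mul_sub] at hle
    linarith
  rw [dyadicStep, dyadicStep]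
  rcases floor_eq_or_eq_add_one_of_le (by gcongr) hscaled with h | h <;> rw [h]
  · rw [dist_self]
    exact hF.mul_pow_nonneg _
  · exact hF.dist_le _ _

theorem exists_tendsto_dyadicStep [CompleteSpace E] (hF : IsGeometricRefinement F K r)
    (hr1 : r < 1) : ∃ g : ℝ → E, ∀ x, Tendsto (dyadicStep F · x) atTop (𝓝 (g x)) := by
  choose g hg using fun x => cauchySeq_tendsto_of_complete
    (cauchySeq_of_le_geometric r (K * r) hr1 (hF.dist_dyadicStep_succ_le · x))
  exact ⟨g, hg⟩

theorem dist_dyadicStep_limit_le (hF : IsGeometricRefinement F K r) (hr1 : r < 1)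
    (hg : ∀ x, Tendsto (dyadicStep F · x) atTop (𝓝 (g x))) (j : ℕ) (x : ℝ) :
    dist (dyadicStep F j x) (g x) ≤ K * r / (1 - r) * r ^ j := by
  rw [div_mul_eq_mul_div]
  exact dist_le_of_le_geometric_of_tendsto r (K * r) hr1 (hF.dist_dyadicStep_succ_le · x) (hg x) j

theorem dist_limit_le (hF : IsGeometricRefinement F K r) (hr1 : r < 1)
    (hg : ∀ x, Tendsto (dyadicStep F · x) atTop (𝓝 (g x))) (j : ℕ) (x y : ℝ)
    (hxy : dist x y ≤ (1 / 2) ^ j) :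
    dist (g x) (g y) ≤ (2 * (K * r / (1 - r)) + K) * r ^ j := by
  have hx := hF.dist_dyadicStep_limit_le hr1 hg j x
  have hy := hF.dist_dyadicStep_limit_le hr1 hg j y
  have hstep := hF.dist_dyadicStep_le hxy
  have htri := dist_triangle4_left (dyadicStep F j x) (dyadicStep F j y) (g x) (g y)
  linarith

theorem isBounded_range_limit (hF : IsGeometricRefinement F K r) (hr1 : r < 1)
    (hg : ∀ x, Tendsto (dyadicStep F · x) atTop (𝓝 (g x)))
    (hF0 : Bornology.IsBounded (Set.range (F 0))) : Bornology.IsBounded (Set.range g) := by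
  obtain ⟨D, hD⟩ := Metric.isBounded_range_iff.1 hF0
  refine Metric.isBounded_range_iff.2 ⟨2 * (K * r / (1 - r)) + D, fun x y => ?_⟩
  have hx := hF.dist_dyadicStep_limit_le hr1 hg 0 x
  have hy := hF.dist_dyadicStep_limit_le hr1 hg 0 y
  have hstep : dist (dyadicStep F 0 x) (dyadicStep F 0 y) ≤ D := hD _ _
  have htri := dist_triangle4_left (dyadicStep F 0 x) (dyadicStep F 0 y) (g x) (g y)
  linarith

end IsGeometricRefinement

section LimitFunction

variable {S : (ℤ → ℝ) → ℤ → ℝ} {f : ℤ → ℝ} {g : ℝ → ℝ} {K r : ℝ}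

theorem IsLimitFunction.tendsto_dyadicStep (hg : IsLimitFunction S f g) (x : ℝ) :
    Tendsto (dyadicStep (fun j => S^[j] f) · x) atTop (𝓝 (g x)) := by
  have hgrid : Tendsto (fun j : ℕ => g (⌊2 ^ j * x⌋ / 2 ^ j)) atTop (𝓝 (g x)) :=
    (hg.1.tendsto x).comp
      ((tendsto_floor_mul_div_atTop x).comp (tendsto_pow_atTop_atTop_of_one_lt one_lt_two))
  rw [tendsto_iff_edist_tendsto_0] at hgrid ⊢
  refine tendsto_of_tendsto_of_tendsto_of_le_of_le tendsto_const_nhds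
    (by simpa using hg.2.add hgrid) (fun _ => zero_le)
    fun j => (edist_triangle _ (g (⌊2 ^ j * x⌋ / 2 ^ j)) _).trans ?_
  gcongr
  exact le_iSup (fun n : ℤ => edist (S^[j] f n) (g (n / 2 ^ j))) ⌊2 ^ j * x⌋

theorem IsGeometricRefinement.exists_isLimitFunction
    (hF : IsGeometricRefinement (fun j => S^[j] f) K r) (hr0 : 0 ≤ r) (hr1 : r < 1) :
    ∃ g, IsLimitFunction S f g := by
  obtain ⟨g, hg⟩ := hF.exists_tendsto_dyadicStep hr1
  refine ⟨g, (uniformContinuous_of_dyadic_modulus hr0 hr1 (hF.dist_limit_le hr1 hg)).continuous, ?_⟩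
  have hlim : Tendsto (fun j : ℕ => ENNReal.ofReal (K * r / (1 - r) * r ^ j)) atTop (𝓝 0) := by
    simpa using ENNReal.tendsto_ofReal
      ((tendsto_pow_atTop_nhds_zero_of_lt_one hr0 hr1).const_mul (K * r / (1 - r)))
  refine tendsto_of_tendsto_of_tendsto_of_le_of_le tendsto_const_nhds hlim
    (fun _ => zero_le) fun j => iSup_le fun n => ?_
  rw [edist_dist, ← dyadicStep_div_two_pow (fun j => S^[j] f) j n]
  exact ENNReal.ofReal_le_ofReal (hF.dist_dyadicStep_limit_le hr1 hg j _)

theorem isBounded_range_of_memℓp_infty {ι E : Type*} [NormedAddCommGroup E] {u : ι → E}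
    (hu : Memℓp u ∞) : Bornology.IsBounded (Set.range u) := by
  obtain ⟨B, hB⟩ := memℓp_infty_iff.1 hu
  exact isBounded_iff_forall_norm_le.2 ⟨B, Set.forall_mem_range.2 fun n => hB ⟨n, rfl⟩⟩

theorem IsLimitFunction.holderMinus {α : ℝ} (hα : 0 < α) (hf : Memℓp f ∞)
    (hg : IsLimitFunction S f g)
    (hF : ∀ a, 0 < a → a < α →
      ∃ K, IsGeometricRefinement (fun j => S^[j] f) K ((1 / 2 : ℝ) ^ a)) :
    HolderMinus α g := by
  have hr1 {a : ℝ} (ha : 0 < a) : (1 / 2 : ℝ) ^ a < 1 :=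
    Real.rpow_lt_one (by norm_num) (by norm_num) ha
  have hbdd : Bornology.IsBounded (Set.range g) := by
    obtain ⟨K, hK⟩ := hF (α / 2) (half_pos hα) (half_lt_self hα)
    exact hK.isBounded_range_limit (hr1 (half_pos hα)) hg.tendsto_dyadicStep
      (isBounded_range_of_memℓp_infty hf)
  refine ⟨hg.1, ?_, fun a ha haα => ?_⟩
  · obtain ⟨B, hB⟩ := hbdd.exists_norm_le
    exact ⟨B, Set.forall_mem_range.1 hB⟩
  · obtain ⟨K, hK⟩ := hF a ha haα
    exact exists_dist_le_mul_rpow_of_dyadic_modulus ha hbdd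
      (hK.dist_limit_le (hr1 ha) hg.tendsto_dyadicStep)

theorem HolderMinus.mono {α β : ℝ} (hg : HolderMinus α g) (hβα : β ≤ α) : HolderMinus β g :=
  ⟨hg.1, hg.2.1, fun a ha haβ => hg.2.2 a ha (haβ.trans_le hβα)⟩

end LimitFunction

theorem exists_add_mul_mul_pow_le (b c : ℝ) {q r : ℝ} (hq : 0 ≤ q) (hqr : q < r) :
    ∃ K, ∀ j : ℕ, (b + c * j) * q ^ j ≤ K * r ^ j := by
  have hr : 0 < r := hq.trans_lt hqr
  have hlin (k : ℕ) : (fun j : ℕ => (j : ℝ) ^ k * q ^ j) =O[atTop] fun j => r ^ j :=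
    (isLittleO_pow_const_mul_const_pow_const_pow_of_norm_lt k
      (by rwa [Real.norm_of_nonneg hq])).isBigO
  have hO : (fun j : ℕ => (b + c * j) * q ^ j) =O[atTop] fun j => r ^ j := by
    refine (((hlin 0).const_mul_left b).add ((hlin 1).const_mul_left c)).congr_left fun j => ?_
    ring
  obtain ⟨K, -, hK⟩ := Asymptotics.bound_of_isBigO_nat_atTop hO
  refine ⟨K, fun j => (le_abs_self _).trans ?_⟩
  simpa [abs_of_pos hr] using hK (pow_ne_zero j hr.ne')

/-- The class of nonlinear means the convergence proof applies to. Values are required to be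
nonnegative also on two negative arguments, because `powerMean` is even, not odd, under
`(x, y) ↦ (-x, -y)`. -/
structure IsNonnegLimitedMean (m : ℝ → ℝ → ℝ) : Prop where
  nonneg : ∀ x y, 0 ≤ m x y
  le_max_abs : ∀ x y, m x y ≤ max |x| |y|
  eq_zero_of_mul_nonpos : ∀ x y, x * y ≤ 0 → m x y = 0

section PowerMean

variable (p : ℕ) {x y : ℝ}

theorem powerMean_neg_neg (x y : ℝ) : powerMean p (-x) (-y) = powerMean p x y := by
  have hquot : (-x - -y) / (-x + -y) = (x - y) / (x + y) := by
    rw [← neg_div_neg_eq]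
    congr 1 <;> ring
  rw [powerMean, powerMean, hquot, Real.sign_neg, Real.sign_neg]
  ring

theorem powerMean_of_mul_nonpos (hxy : x * y ≤ 0) : powerMean p x y = 0 := by
  rcases eq_or_ne x 0 with rfl | hx
  · rcases eq_or_ne y 0 with rfl | hy <;> simp [powerMean, *]
  rcases eq_or_ne y 0 with rfl | hy
  · simp [powerMean, hx]
  have hsign : Real.sign x + Real.sign y = 0 := by
    rcases mul_neg_iff.1 (hxy.lt_of_ne (mul_ne_zero hx hy)) with ⟨h, h'⟩ | ⟨h, h'⟩ <;>
      simp [Real.sign_of_pos, Real.sign_of_neg, h, h']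
  rw [powerMean, hsign, zero_div, zero_mul, zero_mul]

theorem powerMean_mem_Icc_of_pos (hx : 0 < x) (hy : 0 < y) :
    powerMean p x y ∈ Set.Icc 0 ((x + y) / 2) := by
  have hsum : 0 < x + y := by positivity
  have hquot : |(x - y) / (x + y)| ≤ 1 := by
    rw [abs_div, abs_of_pos hsum, div_le_one hsum, abs_le]
    constructor <;> linarith
  have hpow : |(x - y) / (x + y)| ^ p ≤ 1 := pow_le_one₀ (abs_nonneg _) hquot
  have hmean : powerMean p x y = (x + y) / 2 * (1 - |(x - y) / (x + y)| ^ p) := by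
    rw [powerMean, Real.sign_of_pos hx, Real.sign_of_pos hy]
    ring
  rw [hmean]
  exact ⟨mul_nonneg (by positivity) (sub_nonneg.2 hpow),
    mul_le_of_le_one_right (by positivity) (sub_le_self _ (by positivity))⟩

theorem powerMean_mem_Icc_max_abs (x y : ℝ) : powerMean p x y ∈ Set.Icc 0 (max |x| |y|) := by
  have hpos {x y : ℝ} (hx : 0 < x) (hy : 0 < y) : powerMean p x y ∈ Set.Icc 0 (max |x| |y|) := by
    refine Set.Icc_subset_Icc_right ?_ (powerMean_mem_Icc_of_pos p hx hy)
    rw [abs_of_pos hx, abs_of_pos hy]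
    linarith [le_max_left x y, le_max_right x y]
  rcases le_or_gt (x * y) 0 with hxy | hxy
  · rw [powerMean_of_mul_nonpos p hxy]
    exact ⟨le_rfl, by positivity⟩
  rcases mul_pos_iff.1 hxy with ⟨hx, hy⟩ | ⟨hx, hy⟩
  · exact hpos hx hy
  · simpa only [powerMean_neg_neg, abs_neg] using hpos (neg_pos.2 hx) (neg_pos.2 hy)

theorem isNonnegLimitedMean_powerMean : IsNonnegLimitedMean (powerMean p) where
  nonneg x y := (powerMean_mem_Icc_max_abs p x y).1
  le_max_abs x y := (powerMean_mem_Icc_max_abs p x y).2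
  eq_zero_of_mul_nonpos _ _ := powerMean_of_mul_nonpos p

end PowerMean

section Differences

variable (m : ℝ → ℝ → ℝ) (f : ℤ → ℝ) (n : ℤ)

theorem secondDiff_fourPointScheme_odd :
    secondDiff (fourPointScheme m f) (2 * n + 1)
      = 1 / 4 * m (secondDiff f n) (secondDiff f (n + 1)) := by
  rw [secondDiff, fourPointScheme_odd, add_sub_cancel_right,
    show 2 * n + 1 + 1 = 2 * (n + 1) by ring, fourPointScheme_even, fourPointScheme_even]
  ring

theorem secondDiff_fourPointScheme_even :
    secondDiff (fourPointScheme m f) (2 * n)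
      = secondDiff f n / 2 - 1 / 8 * (m (secondDiff f (n - 1)) (secondDiff f n)
        + m (secondDiff f n) (secondDiff f (n + 1))) := by
  rw [secondDiff, fourPointScheme_odd, show 2 * n - 1 = 2 * (n - 1) + 1 by ring,
    fourPointScheme_odd, fourPointScheme_even, sub_add_cancel, secondDiff.eq_1 f n]
  ring

theorem fourPointScheme_iterate_succ_even (j : ℕ) :
    (fourPointScheme m)^[j + 1] f (2 * n) = (fourPointScheme m)^[j] f n := by
  rw [Function.iterate_succ_apply', fourPointScheme_even]

variable {f}

theorem abs_sub_le_of_abs_le {B : ℝ} (hf : ∀ n, |f n| ≤ B) : |f (n + 1) - f n| ≤ 2 * B :=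
  (abs_sub _ _).trans (by linarith [hf n, hf (n + 1)])

theorem abs_secondDiff_le_of_abs_le {B : ℝ} (hf : ∀ n, |f n| ≤ B) : |secondDiff f n| ≤ 4 * B := by
  have hsplit : secondDiff f n = (f (n + 1) - f n) - (f n - f (n - 1)) := by
    rw [secondDiff]
    ring
  have hleft : |f n - f (n - 1)| ≤ 2 * B := by simpa using abs_sub_le_of_abs_le (n - 1) hf
  rw [hsplit]
  exact (abs_sub _ _).trans (by linarith [abs_sub_le_of_abs_le n hf])

end Differences

/-- Sequences whose second differences have no two consecutive negative terms. Refinement produces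
such sequences, and on them the second differences contract by `1 / 2` instead of `3 / 4`. -/
def NoConsecutiveNeg (f : ℤ → ℝ) : Prop := ∀ n, 0 ≤ secondDiff f n ∨ 0 ≤ secondDiff f (n + 1)

namespace IsNonnegLimitedMean

variable {m : ℝ → ℝ → ℝ} {f : ℤ → ℝ} {M : ℝ}

theorem mem_Icc_of_abs_le (hm : IsNonnegLimitedMean m) {x y : ℝ} (hx : |x| ≤ M) (hy : |y| ≤ M) :
    m x y ∈ Set.Icc 0 M :=
  ⟨hm.nonneg x y, (hm.le_max_abs x y).trans (max_le hx hy)⟩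

theorem noConsecutiveNeg_fourPointScheme (hm : IsNonnegLimitedMean m) (f : ℤ → ℝ) :
    NoConsecutiveNeg (fourPointScheme m f) := by
  have hodd (n : ℤ) : 0 ≤ secondDiff (fourPointScheme m f) (2 * n + 1) := by
    rw [secondDiff_fourPointScheme_odd]
    exact mul_nonneg (by norm_num) (hm.nonneg _ _)
  intro k
  obtain ⟨n, rfl | rfl⟩ := Int.even_or_odd' k
  · exact Or.inr (hodd n)
  · exact Or.inl (hodd n)

theorem abs_secondDiff_fourPointScheme_odd_le (hm : IsNonnegLimitedMean m)
    (hM : ∀ n, |secondDiff f n| ≤ M) (n : ℤ) :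
    |secondDiff (fourPointScheme m f) (2 * n + 1)| ≤ M / 4 := by
  have hmean := hm.mem_Icc_of_abs_le (hM n) (hM (n + 1))
  rw [secondDiff_fourPointScheme_odd, abs_of_nonneg (mul_nonneg (by norm_num) hmean.1)]
  linarith [hmean.2]

theorem abs_secondDiff_fourPointScheme_le (hm : IsNonnegLimitedMean m)
    (hM : ∀ n, |secondDiff f n| ≤ M) (k : ℤ) :
    |secondDiff (fourPointScheme m f) k| ≤ 3 / 4 * M := by
  have hM0 : 0 ≤ M := (abs_nonneg _).trans (hM 0)
  obtain ⟨n, rfl | rfl⟩ := Int.even_or_odd' k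
  · have hdiff := abs_le.1 (hM n)
    have hleft := hm.mem_Icc_of_abs_le (hM (n - 1)) (hM n)
    have hright := hm.mem_Icc_of_abs_le (hM n) (hM (n + 1))
    rw [secondDiff_fourPointScheme_even, abs_le]
    constructor <;> linarith [hleft.1, hleft.2, hright.1, hright.2]
  · linarith [hm.abs_secondDiff_fourPointScheme_odd_le hM n]

theorem abs_secondDiff_fourPointScheme_le_half (hm : IsNonnegLimitedMean m)
    (hf : NoConsecutiveNeg f) (hM : ∀ n, |secondDiff f n| ≤ M) (k : ℤ) :
    |secondDiff (fourPointScheme m f) k| ≤ M / 2 := by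
  have hM0 : 0 ≤ M := (abs_nonneg _).trans (hM 0)
  obtain ⟨n, rfl | rfl⟩ := Int.even_or_odd' k
  · rw [secondDiff_fourPointScheme_even, abs_le]
    have hdiff := abs_le.1 (hM n)
    rcases le_or_gt 0 (secondDiff f n) with hn | hn
    · have hleft := hm.mem_Icc_of_abs_le (hM (n - 1)) (hM n)
      have hright := hm.mem_Icc_of_abs_le (hM n) (hM (n + 1))
      constructor <;> linarith [hleft.1, hleft.2, hright.1, hright.2]
    · have hright : 0 ≤ secondDiff f (n + 1) := (hf n).resolve_left hn.not_ge
      have hleft : 0 ≤ secondDiff f (n - 1) :=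
        (hf (n - 1)).resolve_right (by rwa [sub_add_cancel, not_le])
      rw [hm.eq_zero_of_mul_nonpos _ _ (mul_nonpos_of_nonneg_of_nonpos hleft hn.le),
        hm.eq_zero_of_mul_nonpos _ _ (mul_nonpos_of_nonpos_of_nonneg hn.le hright)]
      constructor <;> linarith
  · linarith [hm.abs_secondDiff_fourPointScheme_odd_le hM n]

theorem abs_sub_fourPointScheme_le (hm : IsNonnegLimitedMean m) {E : ℝ}
    (hM : ∀ n, |secondDiff f n| ≤ M) (hE : ∀ n, |f (n + 1) - f n| ≤ E) (k : ℤ) :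
    |fourPointScheme m f (k + 1) - fourPointScheme m f k| ≤ E / 2 + M / 8 := by
  obtain ⟨n, hk⟩ := Int.even_or_odd' k
  have hdiff := abs_le.1 (hE n)
  have hmean := hm.mem_Icc_of_abs_le (hM n) (hM (n + 1))
  rcases hk with rfl | rfl
  · rw [fourPointScheme_odd, fourPointScheme_even, abs_le]
    constructor <;> linarith [hmean.1, hmean.2]
  · rw [show 2 * n + 1 + 1 = 2 * (n + 1) by ring, fourPointScheme_odd, fourPointScheme_even, abs_le]
    constructor <;> linarith [hmean.1, hmean.2]

theorem abs_secondDiff_iterate_succ_le (hm : IsNonnegLimitedMean m)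
    (hM : ∀ n, |secondDiff f n| ≤ M) (j : ℕ) (n : ℤ) :
    |secondDiff ((fourPointScheme m)^[j + 1] f) n| ≤ 3 / 4 * M * (1 / 2) ^ j := by
  induction j generalizing n with
  | zero => simpa using hm.abs_secondDiff_fourPointScheme_le hM n
  | succ j ih =>
    have hnc : NoConsecutiveNeg ((fourPointScheme m)^[j + 1] f) := by
      rw [Function.iterate_succ_apply']
      exact hm.noConsecutiveNeg_fourPointScheme _
    rw [Function.iterate_succ_apply', pow_succ]
    linarith [hm.abs_secondDiff_fourPointScheme_le_half hnc ih n]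

theorem abs_secondDiff_iterate_le (hm : IsNonnegLimitedMean m)
    (hM : ∀ n, |secondDiff f n| ≤ M) (j : ℕ) (n : ℤ) :
    |secondDiff ((fourPointScheme m)^[j] f) n| ≤ 3 / 2 * M * (1 / 2) ^ j := by
  cases j with
  | zero =>
    rw [Function.iterate_zero_apply, pow_zero]
    linarith [hM n, abs_nonneg (secondDiff f n)]
  | succ j => exact (hm.abs_secondDiff_iterate_succ_le hM j n).trans_eq (by ring)

theorem abs_sub_iterate_le (hm : IsNonnegLimitedMean m) {E : ℝ}
    (hM : ∀ n, |secondDiff f n| ≤ M) (hE : ∀ n, |f (n + 1) - f n| ≤ E) (j : ℕ) (n : ℤ) :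
    |(fourPointScheme m)^[j] f (n + 1) - (fourPointScheme m)^[j] f n|
      ≤ (E + 3 / 8 * M * j) * (1 / 2) ^ j := by
  induction j generalizing n with
  | zero => simpa using hE n
  | succ j ih =>
    rw [Function.iterate_succ_apply']
    refine (hm.abs_sub_fourPointScheme_le (hm.abs_secondDiff_iterate_le hM j) ih n).trans_eq ?_
    push_cast
    ring

theorem exists_isGeometricRefinement (hm : IsNonnegLimitedMean m) (hf : Memℓp f ∞) {r : ℝ}
    (hr : 1 / 2 < r) : ∃ K, IsGeometricRefinement (fun j => (fourPointScheme m)^[j] f) K r := by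
  obtain ⟨B, hB⟩ := memℓp_infty_iff.1 hf
  have hB' (n : ℤ) : |f n| ≤ B := hB ⟨n, rfl⟩
  obtain ⟨K, hK⟩ := exists_add_mul_mul_pow_le (2 * B) (3 / 8 * (4 * B)) one_half_pos.le hr
  exact ⟨K, fun j n => fourPointScheme_iterate_succ_even m f n j, fun j n =>
    (hm.abs_sub_iterate_le (abs_secondDiff_le_of_abs_le · hB') (abs_sub_le_of_abs_le · hB')
      j n).trans (hK j)⟩

theorem uniformlyConvergent_fourPointScheme (hm : IsNonnegLimitedMean m) :
    UniformlyConvergent (fourPointScheme m) := by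
  intro f hf
  obtain ⟨K, hK⟩ := hm.exists_isGeometricRefinement hf (by norm_num : (1 / 2 : ℝ) < 3 / 4)
  exact hK.exists_isLimitFunction (by norm_num) (by norm_num)

theorem holderMinus_one (hm : IsNonnegLimitedMean m) {g : ℝ → ℝ} (hf : Memℓp f ∞)
    (hg : IsLimitFunction (fourPointScheme m) f g) : HolderMinus 1 g := by
  refine hg.holderMinus one_pos hf fun a _ ha => hm.exists_isGeometricRefinement hf ?_
  simpa using Real.rpow_lt_rpow_of_exponent_gt one_half_pos one_half_lt_one ha

end IsNonnegLimitedMean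

theorem neg_logb_two_three_quarters_le_one : -Real.logb 2 (3 / 4) ≤ 1 := by
  rw [neg_le, Real.le_logb_iff_rpow_le one_lt_two (by norm_num), Real.rpow_neg_one]
  norm_num

end PowerP

end

theorem mainTheorem4_general {m : ℝ → ℝ → ℝ} (hm : PowerP.IsNonnegLimitedMean m) :
    PowerP.UniformlyConvergent (PowerP.fourPointScheme m) ∧
      ∀ (f : ℤ → ℝ) (g : ℝ → ℝ), Memℓp f ∞ →
        PowerP.IsLimitFunction (PowerP.fourPointScheme m) f g → PowerP.HolderMinus 1 g :=
  ⟨hm.uniformlyConvergent_fourPointScheme, fun _ _ => hm.holderMinus_one⟩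

theorem mainTheorem4 (p : ℕ) (hp : 1 ≤ p) :
    PowerP.UniformlyConvergent (PowerP.powerScheme p) ∧
      ∀ (f : ℤ → ℝ) (g : ℝ → ℝ), Memℓp f ∞ →
        PowerP.IsLimitFunction (PowerP.powerScheme p) f g →
          (p ≤ 4 → PowerP.HolderMinus 1 g) ∧
          (5 ≤ p → PowerP.HolderMinus (-Real.logb 2 (3 / 4)) g) := by
  obtain ⟨hconv, hreg⟩ := mainTheorem4_general (PowerP.isNonnegLimitedMean_powerMean p)
  exact ⟨hconv, fun f g hf hg => ⟨fun _ => hreg f g hf hg,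
    fun _ => (hreg f g hf hg).mono PowerP.neg_logb_two_three_quarters_le_one⟩⟩
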